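/- Let $G$ be a finite group of order $v$, and let $D\subseteq G$ be a regular $(v,k,\lambda,\mu)$-partial difference set: $|D|=k$, $1\notin D$, $D=D^{-1}$, every nonidentity element of $D$ is of the form $gh^{-1}$ with $g\neq h$ in $D$ in exactly $\lambda$ ways, and every nonidentity element of $G\setminus D$ in exactly $\mu$ ways. Assume $0<\mu<k$ and that $\sqrt\Delta$ is an integer, where $\Delta=(\lambda-\mu)^2+4(k-\mu)$, and let $\theta_1=\frac12(\lambda-\mu+\sqrt\Delta)$, $\theta_2=\frac12(\lambda-\mu-\sqrt\Delta)$. Let $\mathcal L$ be the group of linear characters $\xi:G\to\mathbb C^\times$, and write $\xi(D)=\sum_{d\in D}\xi(d)$. (a) Let $H\le\mathcal L$ be a subgroup with $\gcd(|H|,\sqrt\Delta)=1$, and let $N=\bigcap_{\xi\in H}\ker\xi$. Suppose $N<G$ (that is, $N\neq G$). Then there is $\alpha\in\{1,2\}$ such that $\xi(D)=\theta_\alpha$ for every nonprincipal $\xi\in H$; and whenever $\alpha$ has this property, $$|N\cap D|=\frac{k-\theta_\alpha}{|H|}+\theta_\alpha .$$ (b) If $\gcd(v,\sqrt\Delta)=1$,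 then there is $\alpha\in\{1,2\}$ such that $\xi(D)=\theta_\alpha$ for every nonprincipal $\xi\in\mathcal L$; and whenever $\alpha$ has this property, with $G'=[G,G]$, $$|G'\cap D|=\frac{k-\theta_\alpha}{|\mathcal L|}+\theta_\alpha .$$ -/

import Mathlib

/-- `D` is a `(v, k, l, m)`-partial difference set in the group `G` (with `l` for `λ`, `m` for `μ`). -/
structure IsPDS {G : Type*} [Group G] (D : Finset G) (v k l m : ℕ) : Prop where
  card_group : Nat.card G = v
  card_set : D.card = k
  count_mem : ∀ x ∈ D, x ≠ 1 →
    {p : G × G | p.1 ∈ D ∧ p.2 ∈ D ∧ p.1 ≠ p.2 ∧ p.1 * p.2⁻¹ = x}.ncard = l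
  count_not_mem : ∀ x ∉ D, x ≠ 1 →
    {p : G × G | p.1 ∈ D ∧ p.2 ∈ D ∧ p.1 ≠ p.2 ∧ p.1 * p.2⁻¹ = x}.ncard = m

/-- A partial difference set is regular if it is closed under inverses and misses the identity. -/
structure IsRegularPDS {G : Type*} [Group G] (D : Finset G) (v k l m : ℕ) : Prop
    extends IsPDS D v k l m where
  inv_mem : ∀ d ∈ D, d⁻¹ ∈ D
  one_not_mem : (1 : G) ∉ D

/-- The discriminant `Δ = (λ - μ)² + 4 (k - μ)`. -/
def pdsDiscr (k l m : ℕ) : ℤ := ((l : ℤ) - m) ^ 2 + 4 * ((k : ℤ) - m)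

/-- The eigenvalues `θ₁ = (λ - μ + √Δ) / 2` (index `0`) and `θ₂ = (λ - μ - √Δ) / 2` (index `1`). -/
noncomputable def pdsEigenvalue (k l m : ℕ) : Fin 2 → ℝ :=
  ![((l : ℝ) - m + √(pdsDiscr k l m : ℝ)) / 2, ((l : ℝ) - m - √(pdsDiscr k l m : ℝ)) / 2]

/-- The (abelian) group of linear characters of `G`, under pointwise multiplication. -/
abbrev LinearChar (G : Type*) [Group G] : Type _ := G →* ℂˣ

/-- The value `ξ(D) = ∑_{d ∈ D} ξ(d)` of a linear character on a subset. -/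
noncomputable def LinearChar.onSet {G : Type*} [Group G] (ξ : LinearChar G) (D : Finset G) : ℂ :=
  ∑ d ∈ D, ((ξ d : ℂˣ) : ℂ)

/-- The intersection of the kernels of the characters in `H`. -/
def commonKernel {G : Type*} [Group G] (H : Subgroup (LinearChar G)) : Subgroup G :=
  ⨅ ξ ∈ H, MonoidHom.ker ξ

open Finset

/-! ### Linear characters: orthogonality and small Fourier transforms. -/

namespace LinearChar

variable {G : Type*} [Group G]

/-! By the quadratic `onSet_sq`, each nonprincipal `ξ` has `ξ(D) ∈ {θ₁, θ₂}`, where `θ₁ - θ₂ = s =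
√Δ`. Let `A` be the set of nonprincipal `ξ ∈ H` with value `θ₁`, `a = |A|`, `n = |H|`, and `Â(g) =
∑_{ξ ∈ A} ξ(g)`. Fourier inversion over `H` counts the `d ∈ D` with `gd ∈ N`, which makes `s Â(g)`
an integer whose class mod `n` is independent of `g`. As `Â(g)` is an algebraic integer and `gcd(n,
s) = 1`, it is an integer congruent to `Â(1) = a` mod `n`. Size bounds leave only `a` and `a - n`,
and orthogonality then forces `a = 0` or `a = n - 1` (`card_eq_of_sum_modEq`): one eigenvalue never
occurs. The intersection formula is the same inversion at `g = 1`; (b) is the case where `H` is the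
whole character group. -/

lemma pow_card_eq_one (ξ : LinearChar G) (g : G) : (ξ g : ℂ) ^ Nat.card G = 1 := by
  rw [← Units.val_pow_eq_pow_val, ← map_pow, pow_card_eq_one', map_one, Units.val_one]

lemma pow_card_group (ξ : LinearChar G) : ξ ^ Nat.card G = 1 := by
  ext g
  simpa using pow_card_eq_one ξ g

lemma sum_eq_zero [Fintype G] {ξ : LinearChar G} (hξ : ξ ≠ 1) : ∑ g, (ξ g : ℂ) = 0 := by
  refine sum_hom_units_eq_zero ((Units.coeHom ℂ).comp ξ) fun h ↦ hξ ?_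
  ext g
  simpa using DFunLike.congr_fun h g

lemma mem_commonKernel {H : Subgroup (LinearChar G)} {g : G} :
    g ∈ commonKernel H ↔ ∀ ξ ∈ H, ξ g = 1 := by
  simp [commonKernel, Subgroup.mem_iInf, MonoidHom.mem_ker]

/-- The sum over a group of characters of the values at `g`. -/
lemma sum_subgroup_apply (H : Subgroup (LinearChar G)) [Fintype H] (g : G)
    [Decidable (g ∈ commonKernel H)] :
    ∑ ξ : H, ((ξ : LinearChar G) g : ℂ) = if g ∈ commonKernel H then (Nat.card H : ℂ) else 0 := by
  split_ifs with hg
  · rw [sum_congr rfl fun ξ _ ↦ by rw [mem_commonKernel.mp hg ξ ξ.2, Units.val_one]]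
    simp
  · refine sum_hom_units_eq_zero
      ((Units.coeHom ℂ).comp ((MonoidHom.eval g).comp H.subtype)) fun h ↦ hg ?_
    refine mem_commonKernel.mpr fun ξ hξ ↦ ?_
    simpa using DFunLike.congr_fun h ⟨ξ, hξ⟩

lemma sum_subgroup_apply_mul_onSet (H : Subgroup (LinearChar G)) [Fintype H] (D : Finset G)
    (g : G) [DecidablePred (· ∈ commonKernel H)] :
    ∑ ξ : H, ((ξ : LinearChar G) g : ℂ) * (ξ : LinearChar G).onSet D =
      Nat.card H * #{d ∈ D | g * d ∈ commonKernel H} := by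
  simp_rw [onSet, mul_sum, ← Units.val_mul, ← map_mul]
  rw [sum_comm]
  simp_rw [sum_subgroup_apply]
  rw [← sum_filter, sum_const, nsmul_eq_mul, mul_comm]

variable [Finite G]

lemma norm_apply (ξ : LinearChar G) (g : G) : ‖(ξ g : ℂ)‖ = 1 :=
  Complex.norm_eq_one_of_pow_eq_one (pow_card_eq_one ξ g) Nat.card_pos.ne'

lemma isIntegral_apply (ξ : LinearChar G) (g : G) : IsIntegral ℤ (ξ g : ℂ) :=
  IsIntegral.of_pow Nat.card_pos (by rw [pow_card_eq_one]; exact isIntegral_one)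

lemma conj_apply (ξ : LinearChar G) (g : G) :
    (starRingEnd ℂ) (ξ g : ℂ) = ((ξ⁻¹ : LinearChar G) g : ℂ) := by
  rw [MonoidHom.inv_apply, Units.val_inv_eq_inv_val, Complex.inv_eq_conj (norm_apply ξ g)]

instance finite : Finite (LinearChar G) := by
  have : Finite (rootsOfUnity (Nat.card G) ℂ) :=
    have : NeZero (Nat.card G) := ⟨Nat.card_pos.ne'⟩
    inferInstance
  refine Finite.of_injective (β := G → rootsOfUnity (Nat.card G) ℂ)
    (fun ξ g ↦ ⟨ξ g, by
      rw [mem_rootsOfUnity]; ext; simpa using pow_card_eq_one ξ g⟩) fun ξ η h ↦ ?_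
  ext g
  exact congrArg (fun f ↦ (((f g : rootsOfUnity (Nat.card G) ℂ) : ℂˣ) : ℂ)) h

/-- The character group is finite abelian of exponent dividing `|G|`, so its order divides a power
of `|G|`. -/
lemma coprime_card {s : ℕ} (h : Nat.Coprime (Nat.card G) s) :
    Nat.Coprime (Nat.card (LinearChar G)) s :=
  Nat.Coprime.of_dvd_left (card_dvd_exponent_pow_rank' _ pow_card_group)
    (Nat.Coprime.pow_left _ h)

/-- Orthogonality of linear characters. -/
lemma sum_mul_conj [Fintype G] [DecidableEq (LinearChar G)] (ξ η : LinearChar G) :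
    ∑ g, (ξ g : ℂ) * (starRingEnd ℂ) (η g : ℂ) = if ξ = η then (Nat.card G : ℂ) else 0 := by
  have h (g : G) : (ξ g : ℂ) * (starRingEnd ℂ) (η g : ℂ) = ((ξ * η⁻¹ : LinearChar G) g : ℂ) := by
    rw [conj_apply, MonoidHom.mul_apply, Units.val_mul]
  simp_rw [h]
  split_ifs with hξ
  · simp [hξ]
  · exact sum_eq_zero fun h ↦ hξ (mul_inv_eq_one.mp h)

/-- The only sets `A` of nonprincipal characters whose Fourier transform is constant modulo `|H|`
are the two trivial ones. -/
lemma card_eq_of_sum_modEq {H : Subgroup (LinearChar G)} (A : Finset (LinearChar G))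
    (hA : 1 ∉ A) (hlt : #A < Nat.card H)
    (hdvd : ∀ g, ∃ z : ℤ, ∑ ξ ∈ A, (ξ g : ℂ) = #A + Nat.card H * z) :
    #A = 0 ∨ #A + 1 = Nat.card H := by
  classical
  have := Fintype.ofFinite G
  set n := Nat.card H
  set a := #A
  choose z hz using hdvd
  -- The modulus is at most `a < n`, so `a + n z` lies in `[-a, a]`; `z ≤ -2` would give `a ≥ n`.
  have hval (g : G) : z g = 0 ∨ z g = -1 := by
    have hb : ‖∑ ξ ∈ A, (ξ g : ℂ)‖ ≤ a := by
      refine (norm_sum_le _ _).trans ?_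
      simp [norm_apply, a]
    rw [hz g, show (a + n * z g : ℂ) = ((a + n * z g : ℤ) : ℂ) by push_cast; rfl,
      Complex.norm_intCast] at hb
    have hb' : |(a + n * z g : ℤ)| ≤ a := by exact_mod_cast hb
    obtain ⟨h1, h2⟩ := abs_le.mp hb'
    have h3 : z g ≤ 0 := by
      by_contra! h
      nlinarith
    have h4 : -2 < z g := by
      by_contra! h
      nlinarith
    omega
  have hsum : ∑ g, ∑ ξ ∈ A, (ξ g : ℂ) = 0 := by
    rw [sum_comm]
    exact Finset.sum_eq_zero fun ξ hξ ↦ sum_eq_zero fun h ↦ hA (h ▸ hξ)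
  have hsq : ∑ g, (∑ ξ ∈ A, (ξ g : ℂ)) * (starRingEnd ℂ) (∑ ξ ∈ A, (ξ g : ℂ)) =
      Nat.card G * a := by
    simp_rw [map_sum, sum_mul_sum]
    rw [sum_comm]
    simp_rw [sum_comm (s := univ) (t := A), sum_mul_conj, sum_ite_eq]
    rw [sum_ite_mem, inter_self, sum_const, nsmul_eq_mul, mul_comm]
  -- Both possible values `a` and `a - n` are real roots of `x² = (2a - n)x - a(a - n)`.
  have hpt (g : G) : (∑ ξ ∈ A, (ξ g : ℂ)) * (starRingEnd ℂ) (∑ ξ ∈ A, (ξ g : ℂ)) =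
      (2 * a - n) * ∑ ξ ∈ A, (ξ g : ℂ) - a * (a - n) := by
    rw [hz g]
    obtain h | h := hval g <;> simp [h] <;> ring
  have key : (Nat.card G : ℂ) * a = Nat.card G * (a * (n - a)) := by
    rw [← hsq, sum_congr rfl fun g _ ↦ hpt g, sum_sub_distrib, ← mul_sum, hsum]
    simp
    ring
  have hG : (Nat.card G : ℂ) ≠ 0 := Nat.cast_ne_zero.mpr Nat.card_pos.ne'
  have key' : (a : ℤ) = a * (n - a) := by exact_mod_cast mul_left_cancel₀ hG key
  by_cases ha : a = 0
  · exact .inl ha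
  · right
    have : (1 : ℤ) = n - a :=
      mul_left_cancel₀ (Int.natCast_ne_zero.mpr ha) (by rw [mul_one]; exact key')
    omega

end LinearChar

/-! ### Integrality of the values and of the eigenvalues. -/

lemma exists_int_of_isIntegral_of_mul_eq {x : ℂ} (hx : IsIntegral ℤ x) {s : ℕ} (hs : s ≠ 0)
    {t : ℤ} (h : s * x = t) : ∃ z : ℤ, x = z := by
  have hxq : x = algebraMap ℚ ℂ (t / s) := by
    rw [eq_ratCast]
    push_cast
    rw [eq_div_iff (Nat.cast_ne_zero.mpr hs), mul_comm, h]
  rw [hxq, isIntegral_algebraMap_iff (algebraMap ℚ ℂ).injective] at hx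
  obtain ⟨z, hz⟩ := IsIntegrallyClosed.isIntegral_iff.mp hx
  exact ⟨z, by rw [hxq, ← hz]; simp⟩

lemma pdsEigenvalue_eq_intCast {k l m s : ℕ} (hs : pdsDiscr k l m = (s : ℤ) ^ 2) :
    ∃ t : ℤ, pdsEigenvalue k l m 0 = t + s ∧ pdsEigenvalue k l m 1 = t := by
  have hsqrt : √(pdsDiscr k l m : ℝ) = s := by
    rw [hs]
    push_cast
    exact Real.sqrt_sq (Nat.cast_nonneg s)
  -- `Δ = s²` and `(λ - μ)²` have the same parity, hence so do `s` and `λ - μ`.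
  have heven : Even ((l : ℤ) - m - s) := by
    have h : Even (((l : ℤ) - m) ^ 2 - (s : ℤ) ^ 2) := by
      rw [← hs, pdsDiscr]
      exact ⟨-(2 * ((k : ℤ) - m)), by ring⟩
    rw [Int.even_sub, Int.even_pow' two_ne_zero, Int.even_pow' two_ne_zero] at h
    exact Int.even_sub.mpr h
  obtain ⟨t, ht⟩ := heven
  have ht' : (l : ℝ) - m - s = t + t := by exact_mod_cast ht
  refine ⟨t, ?_, ?_⟩ <;> simp [pdsEigenvalue, hsqrt] <;> linarith

/-! ### Character values on a partial difference set. -/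

namespace IsRegularPDS

variable {G : Type*} [Group G] {D : Finset G} {v k l m : ℕ}

lemma sum_inv (hD : IsRegularPDS D v k l m) (f : G → ℂ) : ∑ d ∈ D, f d⁻¹ = ∑ d ∈ D, f d :=
  sum_nbij' (·⁻¹) (·⁻¹) hD.inv_mem hD.inv_mem (by simp) (by simp) (by simp)

lemma card_mul_inv_eq [DecidableEq G] (hD : IsRegularPDS D v k l m) (x : G) :
    (#{p ∈ D ×ˢ D | p.1 * p.2⁻¹ = x} : ℂ) =
      m + (if x = 1 then (k : ℂ) - m else 0) + if x ∈ D then (l : ℂ) - m else 0 := by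
  by_cases hx : x = 1
  · subst hx
    have : #{p ∈ D ×ˢ D | p.1 * p.2⁻¹ = 1} = k := by
      rw [← hD.card_set, ← D.diag_card]
      congr 1
      ext p
      simp only [mem_filter, mem_product, mem_diag, mul_inv_eq_one]
      grind
    simp [this, hD.one_not_mem]
  · have hset : {p : G × G | p.1 ∈ D ∧ p.2 ∈ D ∧ p.1 ≠ p.2 ∧ p.1 * p.2⁻¹ = x} =
        ({p ∈ D ×ˢ D | p.1 * p.2⁻¹ = x} : Finset (G × G)) := by
      ext p
      simp only [Set.mem_ofPred_eq, coe_filter, mem_product]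
      refine ⟨fun h ↦ ⟨⟨h.1, h.2.1⟩, h.2.2.2⟩, fun h ↦ ⟨h.1.1, h.1.2, fun h' ↦ hx ?_, h.2⟩⟩
      rw [← h.2, h', mul_inv_cancel]
    by_cases hxD : x ∈ D
    · have := hD.count_mem x hxD hx
      rw [hset, Set.ncard_coe_finset] at this
      simp [this, hx, hxD]
    · have := hD.count_not_mem x hxD hx
      rw [hset, Set.ncard_coe_finset] at this
      simp [this, hx, hxD]

variable [Finite G]

/-- Since `D = D⁻¹`, the square is the sum of `ξ(gh⁻¹)` over `D × D`. Grouping by `gh⁻¹`, the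
constant multiplicity `μ` sums to zero over `G`. -/
lemma onSet_sq (hD : IsRegularPDS D v k l m) {ξ : LinearChar G} (hξ : ξ ≠ 1) :
    ξ.onSet D ^ 2 = (k - m) + (l - m) * ξ.onSet D := by
  classical
  have := Fintype.ofFinite G
  have h : ξ.onSet D ^ 2 = ∑ x, #{p ∈ D ×ˢ D | p.1 * p.2⁻¹ = x} * (ξ x : ℂ) := by
    rw [sq]
    nth_rewrite 2 [LinearChar.onSet]
    rw [← hD.sum_inv, LinearChar.onSet, sum_mul_sum, ← sum_product',
      ← sum_fiberwise (D ×ˢ D) (fun p ↦ p.1 * p.2⁻¹)]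
    refine sum_congr rfl fun x _ ↦ ?_
    rw [← nsmul_eq_mul, ← sum_const]
    refine sum_congr rfl fun p hp ↦ ?_
    rw [← (mem_filter.mp hp).2, map_mul, Units.val_mul]
  rw [h]
  simp_rw [hD.card_mul_inv_eq, add_mul, sum_add_distrib, ite_mul, zero_mul]
  rw [← mul_sum, LinearChar.sum_eq_zero hξ]
  simp [LinearChar.onSet, mul_sum]

lemma onSet_eq (hD : IsRegularPDS D v k l m) {ξ : LinearChar G} (hξ : ξ ≠ 1)
    (hΔ : 0 ≤ pdsDiscr k l m) :
    ξ.onSet D = (pdsEigenvalue k l m 0 : ℂ) ∨ ξ.onSet D = (pdsEigenvalue k l m 1 : ℂ) := by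
  have h := hD.onSet_sq hξ
  have hsq : ((√(pdsDiscr k l m : ℝ) : ℝ) : ℂ) ^ 2 = (l - m) ^ 2 + 4 * (k - m) := by
    rw [← Complex.ofReal_pow, Real.sq_sqrt (Int.cast_nonneg hΔ)]
    simp [pdsDiscr]
  rw [← sub_eq_zero, ← sub_eq_zero (a := ξ.onSet D) (b := (pdsEigenvalue k l m 1 : ℂ)),
    ← mul_eq_zero]
  simp only [pdsEigenvalue, Matrix.cons_val_zero, Matrix.cons_val_one]
  push_cast
  linear_combination h - hsq / 4

/-- If all nonprincipal characters in `H` take the same value on `D`, then this value determines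
the size of the intersection of `D` with the common kernel of `H`. -/
lemma ncard_commonKernel_inter (hD : IsRegularPDS D v k l m) (H : Subgroup (LinearChar G))
    {θ : ℝ} (hθ : ∀ ξ ∈ H, ξ ≠ 1 → ξ.onSet D = (θ : ℂ)) :
    (((commonKernel H : Set G) ∩ (D : Set G)).ncard : ℝ) = (k - θ) / (Nat.card H : ℝ) + θ := by
  classical
  have := Fintype.ofFinite H
  have hset : (commonKernel H : Set G) ∩ D = ({d ∈ D | 1 * d ∈ commonKernel H} : Finset G) := by
    ext d
    simp [and_comm]
  have h := LinearChar.sum_subgroup_apply_mul_onSet H D 1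
  have h1 : ∀ ξ : H, (((ξ : LinearChar G) 1 : ℂˣ) : ℂ) * (ξ : LinearChar G).onSet D =
      θ + if ξ = 1 then (k - θ : ℂ) else 0 := by
    intro ξ
    rw [map_one, Units.val_one, one_mul]
    split_ifs with hξ
    · simp [hξ, LinearChar.onSet, hD.card_set]
    · rw [hθ ξ ξ.2 (by simpa using hξ), add_zero]
  rw [sum_congr rfl fun ξ _ ↦ h1 ξ, sum_add_distrib] at h
  simp only [sum_const, card_univ, nsmul_eq_mul, sum_ite_eq', mem_univ, if_true,
    ← Nat.card_eq_fintype_card] at h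
  rw [hset, Set.ncard_coe_finset]
  have hn : (Nat.card H : ℝ) ≠ 0 := Nat.cast_ne_zero.mpr Nat.card_pos.ne'
  have h' : (Nat.card H : ℝ) * θ + (k - θ) =
      Nat.card H * #{d ∈ D | 1 * d ∈ commonKernel H} := by exact_mod_cast h
  field_simp
  linarith

/-- The nonprincipal characters in a group of order prime to `√Δ` all take the same value. -/
lemma exists_onSet_eq (hD : IsRegularPDS D v k l m) {s : ℕ} (hs0 : s ≠ 0)
    (hs : pdsDiscr k l m = (s : ℤ) ^ 2) (H : Subgroup (LinearChar G))
    (hH : Nat.Coprime (Nat.card H) s) :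
    ∃ α : Fin 2, ∀ ξ ∈ H, ξ ≠ 1 → ξ.onSet D = (pdsEigenvalue k l m α : ℂ) := by
  classical
  have := Fintype.ofFinite H
  obtain ⟨t, ht0, ht1⟩ := pdsEigenvalue_eq_intCast hs
  have hval {ξ : LinearChar G} (hξ : ξ ≠ 1) := hD.onSet_eq hξ (hs ▸ sq_nonneg _)
  set n := Nat.card H with hn
  let B : Finset H := {ξ | ξ ≠ 1 ∧ (ξ : LinearChar G).onSet D = (pdsEigenvalue k l m 0 : ℂ)}
  let A : Finset (LinearChar G) := B.map (Function.Embedding.subtype _)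
  have hBsub : B ⊆ univ.erase 1 := fun ξ hξ ↦ by simpa using (mem_filter.mp hξ).2.1
  have hcard : #((univ : Finset H).erase 1) + 1 = n := by
    rw [card_erase_add_one (mem_univ _), card_univ, hn, Nat.card_eq_fintype_card]
  have hAB : #A = #B := card_map _
  -- With `θ₂ = t` and `θ₁ = t + s`, write `ξ(D)` as `t` plus corrections: `k - t` at the principal
  -- character, `s` on `B`.
  have hterm (g : G) (ξ : H) : ((ξ : LinearChar G) g : ℂ) * (ξ : LinearChar G).onSet D =
      t * ((ξ : LinearChar G) g : ℂ) + (if ξ = 1 then (k - t : ℂ) else 0) +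
        if ξ ∈ B then s * ((ξ : LinearChar G) g : ℂ) else 0 := by
    by_cases h1 : ξ = 1
    · have : (1 : H) ∉ B := by simp [B]
      simp [h1, this, LinearChar.onSet, hD.card_set]
    · by_cases hB : ξ ∈ B
      · rw [(mem_filter.mp hB).2.2, ht0]
        simp [h1, hB]
        ring
      · have : (ξ : LinearChar G).onSet D = (pdsEigenvalue k l m 1 : ℂ) :=
          (hval (by simpa using h1)).resolve_left fun h ↦ hB (by simp [B, h1, h])
        rw [this, ht1]
        simp [h1, hB]
        ring
  have hfourier (g : G) : ∃ w : ℤ, s * ∑ ξ ∈ A, (ξ g : ℂ) = n * w + t - k := by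
    have h := LinearChar.sum_subgroup_apply_mul_onSet H D g
    rw [sum_congr rfl fun ξ _ ↦ hterm g ξ, sum_add_distrib, sum_add_distrib, ← mul_sum,
      LinearChar.sum_subgroup_apply, sum_ite_mem, univ_inter, ← mul_sum, sum_ite_eq',
      if_pos (mem_univ _)] at h
    refine ⟨#{d ∈ D | g * d ∈ commonKernel H} - if g ∈ commonKernel H then t else 0, ?_⟩
    rw [sum_map]
    simp only [Function.Embedding.subtype_apply]
    split_ifs at h ⊢ <;> push_cast <;> linear_combination h
  have hint (g : G) : ∃ z : ℤ, ∑ ξ ∈ A, (ξ g : ℂ) = z := by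
    obtain ⟨w, hw⟩ := hfourier g
    refine exists_int_of_isIntegral_of_mul_eq (t := n * w + t - k)
      (IsIntegral.sum _ fun ξ _ ↦ ξ.isIntegral_apply g) hs0 ?_
    rw [hw]
    push_cast
    rfl
  have hmod (g : G) : ∃ z : ℤ, ∑ ξ ∈ A, (ξ g : ℂ) = #A + n * z := by
    obtain ⟨w, hw⟩ := hfourier g
    -- Subtracting the case `g = 1` cancels `t - k`.
    obtain ⟨w₁, hw₁⟩ := hfourier 1
    obtain ⟨y, hy⟩ := hint g
    rw [hy] at hw
    simp only [map_one, Units.val_one, sum_const, nsmul_eq_mul, mul_one] at hw₁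
    have hdvd : (n : ℤ) ∣ s * (y - #A) := by
      refine ⟨w - w₁, ?_⟩
      have : (s * (y - #A) : ℂ) = n * (w - w₁) := by linear_combination hw - hw₁
      exact_mod_cast this
    obtain ⟨z, hz⟩ := (Nat.isCoprime_iff_coprime.mpr hH).dvd_of_dvd_mul_left hdvd
    refine ⟨z, ?_⟩
    have hz' : (y - #A : ℂ) = n * z := by exact_mod_cast hz
    rw [hy]
    linear_combination hz'
  have hlt : #A < n := by
    have := card_le_card hBsub
    omega
  have hA1 : 1 ∉ A := by simp [A, B]
  obtain h | h := LinearChar.card_eq_of_sum_modEq A hA1 hlt hmod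
  · refine ⟨1, fun ξ hξ hξ1 ↦ (hval hξ1).resolve_left fun h0 ↦ ?_⟩
    rw [hAB, card_eq_zero] at h
    exact notMem_empty (⟨ξ, hξ⟩ : H) (h ▸ mem_filter.mpr ⟨mem_univ _, by simpa using hξ1, h0⟩)
  · refine ⟨0, fun ξ hξ hξ1 ↦ ?_⟩
    have hB : B = univ.erase 1 := eq_of_subset_of_card_le hBsub (by omega)
    have : (⟨ξ, hξ⟩ : H) ∈ B := by rw [hB]; simpa using hξ1
    exact (mem_filter.mp this).2.2

end IsRegularPDS

/-- Linear characters separate the points of the abelianization. -/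
lemma commonKernel_top {G : Type*} [Group G] [Finite G] :
    commonKernel (⊤ : Subgroup (LinearChar G)) = commutator G := by
  refine le_antisymm (fun g hg ↦ ?_) fun g hg ↦ ?_
  · by_contra hgc
    have hne : Abelianization.of g ≠ 1 := fun h ↦ hgc ((QuotientGroup.eq_one_iff g).mp h)
    have : NeZero (Monoid.exponent (Abelianization G)) :=
      ⟨Monoid.exponent_ne_zero_of_finite⟩
    obtain ⟨φ, hφ⟩ :=
      CommGroup.exists_apply_ne_one_of_hasEnoughRootsOfUnity (Abelianization G) ℂ hne
    exact hφ (LinearChar.mem_commonKernel.mp hg (φ.comp Abelianization.of) trivial)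
  · exact LinearChar.mem_commonKernel.mpr fun ξ _ ↦
      Abelianization.commutator_subset_ker ξ hg

theorem theorem3p16 {G : Type*} [Group G] [Finite G] (D : Finset G) (v k l m s : ℕ)
    (hD : IsRegularPDS D v k l m) (hm : 0 < m) (hmk : m < k)
    (hs : pdsDiscr k l m = (s : ℤ) ^ 2) :
    (∀ H : Subgroup (LinearChar G), Nat.Coprime (Nat.card H) s → commonKernel H < ⊤ →
      (∃ α : Fin 2, ∀ ξ ∈ H, ξ ≠ 1 → ξ.onSet D = (pdsEigenvalue k l m α : ℂ)) ∧
      ∀ α : Fin 2, (∀ ξ ∈ H, ξ ≠ 1 → ξ.onSet D = (pdsEigenvalue k l m α : ℂ)) →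
        (((commonKernel H : Set G) ∩ (D : Set G)).ncard : ℝ) =
          ((k : ℝ) - pdsEigenvalue k l m α) / (Nat.card H : ℝ) + pdsEigenvalue k l m α) ∧
    (Nat.Coprime v s →
      (∃ α : Fin 2, ∀ ξ : LinearChar G, ξ ≠ 1 → ξ.onSet D = (pdsEigenvalue k l m α : ℂ)) ∧
      ∀ α : Fin 2,
        (∀ ξ : LinearChar G, ξ ≠ 1 → ξ.onSet D = (pdsEigenvalue k l m α : ℂ)) →
        (((commutator G : Set G) ∩ (D : Set G)).ncard : ℝ) =
          ((k : ℝ) - pdsEigenvalue k l m α) / (Nat.card (LinearChar G) : ℝ)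
            + pdsEigenvalue k l m α) := by
  -- `Δ ≥ 4(k - μ) > 0`.
  have hs0 : s ≠ 0 := by
    rintro rfl
    have : (m : ℤ) < k := by exact_mod_cast hmk
    rw [pdsDiscr] at hs
    push_cast at hs
    nlinarith [sq_nonneg ((l : ℤ) - m)]
  refine ⟨fun H hH _ ↦ ⟨hD.exists_onSet_eq hs0 hs H hH,
    fun α hα ↦ hD.ncard_commonKernel_inter H hα⟩, fun hv ↦ ⟨?_, fun α hα ↦ ?_⟩⟩
  · rw [← hD.card_group] at hv
    obtain ⟨α, hα⟩ := hD.exists_onSet_eq hs0 hs ⊤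
      (by rw [Subgroup.card_top]; exact LinearChar.coprime_card hv)
    exact ⟨α, fun ξ ↦ hα ξ trivial⟩
  · have h := hD.ncard_commonKernel_inter ⊤ fun ξ _ ↦ hα ξ
    rwa [commonKernel_top, Subgroup.card_top] at h
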